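/- All graphs are finite, simple and have at least one vertex. A graph is traceable if it has a path containing all of its vertices. A graph $G$ is $S$-free if no induced subgraph of $G$ is isomorphic to $S$. A graph $G$ on $n$ vertices is claw-$o_{-1}$-heavy if every induced subgraph of $G$ isomorphic to the claw $K_{1,3}$ contains two distinct nonadjacent vertices $x,y$ with $d_G(x)+d_G(y)\ge n-1$. Let $P_i$ denote the path on $i$ vertices, $C_3$ the triangle, and $Z_1$ the graph obtained from a triangle by adding one new vertex adjacent to exactly one vertex of the triangle. Theorem 9. Let $S$ be a connected graph on at least three vertices that is not isomorphic to $P_3$. Then the following are equivalent: (a) every connected claw-$o_{-1}$-heavy $S$-free graph is traceable; (b) $S$ is isomorphic to $C_3$, $Z_1$ or $P_4$. -/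

import Mathlib

universe u v

namespace SimpleGraph

/-- A graph is traceable if it has a Hamilton path, i.e. a path containing all vertices. -/
def IsTraceable {V : Type*} (G : SimpleGraph V) : Prop :=
  ∃ (a b : V) (p : G.Walk a b), p.IsPath ∧ ∀ w : V, w ∈ p.support

/-- `G` is `H`-free: no induced subgraph of `G` is isomorphic to `H`. -/
def IsInducedFree {U V : Type*} (G : SimpleGraph V) (H : SimpleGraph U) : Prop :=
  ∀ s : Set V, ¬ Nonempty (H ≃g G.induce s)

/-- The subgraph of `G` induced by `s` is `o₋₁`-heavy: `s` contains two nonadjacent vertices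
whose degree sum in `G` is at least `n - 1`, where `n` is the order of `G`. -/
def IsOMinusOneHeavyOn {V : Type*} [Fintype V] (G : SimpleGraph V) [DecidableRel G.Adj]
    (s : Set V) : Prop :=
  ∃ x ∈ s, ∃ y ∈ s, x ≠ y ∧ ¬ G.Adj x y ∧ Fintype.card V - 1 ≤ G.degree x + G.degree y

/-- `G` is `H`-`o₋₁`-heavy: every induced subgraph of `G` isomorphic to `H` is `o₋₁`-heavy. -/
def IsOMinusOneHeavy {U V : Type*} [Fintype V] (G : SimpleGraph V) [DecidableRel G.Adj]
    (H : SimpleGraph U) : Prop :=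
  ∀ s : Set V, Nonempty (H ≃g G.induce s) → G.IsOMinusOneHeavyOn s

/-- The claw `K_{1,3}`. -/
def claw : SimpleGraph (Fin 1 ⊕ Fin 3) := completeBipartiteGraph (Fin 1) (Fin 3)

/-- The graph `Z₁`: a triangle `0, 1, 2` together with a vertex `3` adjacent only to `2`. -/
def graphZ1 : SimpleGraph (Fin 4) := fromEdgeSet {s(0, 1), s(0, 2), s(1, 2), s(2, 3)}

end SimpleGraph

/-! Sufficiency rests on an Ore-type exchange: if d(x) + d(y) ≥ n - 1, two disjoint paths, one
ending in x and one starting in y, can be replaced by a single path at least as long as both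
(`exists_pathList_of_degree_add_degree`). A heavy pair is therefore as good as an edge when arguing
against a longest path. Applied to a claw centred at a supposed common neighbour, this shows that a
vertex off a longest path has no common neighbour with either end (`no_common_neighbor_head`,
`no_common_neighbor_last`). Claw-heavy graphs of diameter at most two are thus traceable, which
settles connected P₄-free graphs and connected Z₁-free graphs containing a triangle.

What remains is the triangle-free case. If x lies off a longest path and is adjacent to c on it, the
path-neighbours a, b of c form a heavy pair. The one of larger degree, say b, has a neighbour t such
that both degrees are at least (n - 1)/2. Their neighbourhoods are disjoint and miss a vertex, so
they cover everything else exactly. The path then almost alternates between N(b) and N(t), and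
counting along it gives a contradiction.

For necessity, two connected claw-heavy graphs with three leaves each, hence not traceable, must
both contain S as an induced subgraph. The connected induced subgraphs of `net` on at least three
vertices are P₃, C₃, Z₁, P₄ or contain a bull, and `bullFreeNet` excludes the bull. -/

namespace List

/-! ### Counting along consecutive pairs of a list -/

variable {α : Type*}

theorem isChain_of_forall_append {R : α → α → Prop} {l : List α}
    (h : ∀ A B u v, l = A ++ u :: v :: B → R u v) : l.IsChain R := by
  induction l with
  | nil => exact .nil
  | cons a t ih =>
    cases t with
    | nil => exact .singleton a
    | cons b t =>
      refine .cons_cons (h [] t a b rfl) (ih fun A B u v e => h (a :: A) B u v ?_)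
      rw [e, cons_append]

/-- Each of the `l.length - 1` consecutive pairs `(u, v)` contributes at most one of `p u`, `q v`;
the last entry contributes nothing to the count of `p`. -/
theorem countP_add_countP_tail_le (p q : α → Bool) {l : List α} (hne : l ≠ [])
    (hc : l.IsChain fun u v => ¬ (p u ∧ q v)) (hl : p (l.getLast hne) = false) :
    l.countP p + l.tail.countP q + 1 ≤ l.length := by
  induction l with
  | nil => exact absurd rfl hne
  | cons a t ih =>
    cases t with
    | nil => simp_all
    | cons b t =>
      rw [isChain_cons_cons] at hc
      have := ih (by simp) hc.2 (by simpa using hl)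
      have h1 := hc.1
      simp only [tail_cons, length_cons, countP_cons] at this ⊢
      cases hp : p a <;> cases hq : q b <;> simp_all <;> omega

/-- Passing to the successor injects the positions satisfying `p` into those of the tail satisfying
`q`. -/
theorem countP_le_countP_tail (p q : α → Bool) {l : List α} (hne : l ≠ [])
    (hc : l.IsChain fun u v => p u → q v) (hl : p (l.getLast hne) = false) :
    l.countP p ≤ l.tail.countP q := by
  induction l with
  | nil => exact absurd rfl hne
  | cons a t ih =>
    cases t with
    | nil => simp_all
    | cons b t =>
      rw [isChain_cons_cons] at hc
      have := ih (by simp) hc.2 (by simpa using hl)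
      have h1 := hc.1
      simp only [tail_cons, countP_cons] at this ⊢
      cases hp : p a <;> cases hq : q b <;> simp_all <;> omega

theorem countP_tail_le_countP (p q : α → Bool) {l : List α}
    (hc : l.IsChain fun u v => p v → q u) : l.tail.countP p ≤ l.countP q := by
  induction l with
  | nil => simp
  | cons a t ih =>
    cases t with
    | nil => simp
    | cons b t =>
      rw [isChain_cons_cons] at hc
      have := ih hc.2
      have h1 := hc.1
      simp only [tail_cons, countP_cons] at this ⊢
      cases hp : p b <;> cases hq : q a <;> simp_all <;> omega

theorem Nodup.countP_mem_eq_card [DecidableEq α] {l : List α} (hl : l.Nodup) (s : Finset α) :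
    l.countP (· ∈ s) = (l.toFinset ∩ s).card := by
  rw [countP_eq_length_filter, ← toFinset_card_of_nodup (hl.filter _)]
  congr 1
  ext a
  simp

end List

/-! ### Joining two paths at a heavy pair -/

namespace SimpleGraph

variable {V : Type*} {G : SimpleGraph V}

/-- A list of distinct vertices, consecutive ones being adjacent. -/
def IsPathList (G : SimpleGraph V) (l : List V) : Prop :=
  l.IsChain G.Adj ∧ l.Nodup

theorem IsPathList.reverse {l : List V} (h : G.IsPathList l) : G.IsPathList l.reverse :=
  ⟨List.isChain_reverse.2 (h.1.imp fun _ _ => Adj.symm), List.nodup_reverse.2 h.2⟩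

theorem IsPathList.isTraceable {l : List V} (h : G.IsPathList l) (hne : l ≠ [])
    (hall : ∀ v, v ∈ l) : G.IsTraceable := by
  refine ⟨_, _, Walk.ofSupport l hne h.1, ?_, ?_⟩
  · rw [Walk.isPath_def, Walk.support_ofSupport]
    exact h.2
  · rwa [Walk.support_ofSupport]

theorem IsTraceable.exists_pathList (h : G.IsTraceable) :
    ∃ l, G.IsPathList l ∧ ∀ v, v ∈ l := by
  obtain ⟨a, b, p, hp, hall⟩ := h
  exact ⟨p.support, ⟨p.isChain_adj_support, hp.support_nodup⟩, hall⟩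

theorem IsPathList.append {l m : List V} (hl : G.IsPathList l) (hm : G.IsPathList m)
    (hd : l.Disjoint m) (h : ∀ u ∈ l.getLast?, ∀ v ∈ m.head?, G.Adj u v) :
    G.IsPathList (l ++ m) :=
  ⟨List.isChain_append.2 ⟨hl.1, hm.1, h⟩, hl.2.append hm.2 hd⟩

theorem IsPathList.left {l m : List V} (h : G.IsPathList (l ++ m)) : G.IsPathList l :=
  ⟨(List.isChain_append.1 h.1).1, (List.nodup_append.1 h.2).1⟩

theorem IsPathList.right {l m : List V} (h : G.IsPathList (l ++ m)) : G.IsPathList m :=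
  ⟨(List.isChain_append.1 h.1).2.1, (List.nodup_append.1 h.2).2.1⟩

theorem isPathList_singleton (v : V) : G.IsPathList [v] := ⟨.singleton v, by simp⟩

/-- If the ends `x`, `y` of two disjoint paths have enough neighbours on these paths, then some
path is at least as long as both paths together. -/
theorem exists_pathList_of_not_countP_le [DecidableRel G.Adj] {A B : List V} {x y : V}
    (hA : G.IsPathList (A ++ [x])) (hB : G.IsPathList (y :: B))
    (hd : (A ++ [x]).Disjoint (y :: B))
    (h : (A ++ [x]).length + (y :: B).length <
      ((A ++ [x]).countP (G.Adj x ·) + (A ++ [x]).countP (G.Adj y ·)) +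
        ((y :: B).countP (G.Adj x ·) + (y :: B).countP (G.Adj y ·)) + 2) :
    ∃ L, G.IsPathList L ∧ (A ++ [x]).length + (y :: B).length ≤ L.length := by
  by_contra hno
  push Not at hno
  have key : ∀ L, G.IsPathList L → L.Perm ((A ++ [x]) ++ (y :: B)) → False := by
    intro L hL hp
    have := hno L hL
    rw [hp.length_eq, List.length_append] at this
    exact lt_irrefl _ this
  have keyc : ∀ L : List V, L.IsChain G.Adj → L.Perm ((A ++ [x]) ++ (y :: B)) → False := fun L hL hp =>
    key L ⟨hL, hp.nodup_iff.2 (hA.2.append hB.2 hd)⟩ hp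
  have hA1 := hA.1
  have hB1 := hB.1
  -- If x ~ u and y ~ v for consecutive u, v on the first path, go up to u, jump to x, walk back to
  -- v and continue with y: this uses every vertex of both paths.
  have h1 : (A ++ [x]).countP (G.Adj x ·) + (A ++ [x]).tail.countP (G.Adj y ·) + 1
      ≤ (A ++ [x]).length := by
    refine List.countP_add_countP_tail_le _ _ (by simp) ?_ (by simp)
    refine List.isChain_of_forall_append fun C D u v e hadj => ?_
    simp only [decide_eq_true_eq] at hadj
    have hv : (v :: D).getLast? = some x := by
      have := congrArg List.getLast? e
      simpa [List.getLast?_append] using this.symm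
    have hr : (v :: D).reverse.head? = some x := by rw [List.head?_reverse, hv]
    rw [e] at hA1
    refine keyc ((C ++ [u]) ++ ((v :: D).reverse ++ (y :: B))) ?_ ?_
    · obtain ⟨hC, -, hD⟩ := List.isChain_append_cons_cons.1 hA1
      refine List.isChain_append.2 ⟨hC, List.isChain_append.2 ⟨List.isChain_reverse.2
        (hD.imp fun _ _ => Adj.symm), hB1, ?_⟩, ?_⟩
      · simpa using hadj.2.symm
      · rw [List.head?_append, hr]
        simpa using hadj.1.symm
    · rw [e, ← List.append_assoc, List.append_cons C u (v :: D)]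
      exact ((v :: D).reverse_perm.append_left _).append_right _
  -- The same exchange on the second path: x jumps to u, back to y, on to v. The last vertex is not
  -- adjacent to x, since otherwise the second path could be appended reversed.
  have h2 : (y :: B).countP (G.Adj x ·) + (y :: B).tail.countP (G.Adj y ·) + 1
      ≤ (y :: B).length := by
    refine List.countP_add_countP_tail_le _ _ (by simp) ?_ ?_
    · refine List.isChain_of_forall_append fun C D u v e hadj => ?_
      simp only [decide_eq_true_eq] at hadj
      have hv : (C ++ [u]).head? = some y := by
        have := congrArg List.head? e
        cases C <;> simp_all
      have hr : (C ++ [u]).reverse.getLast? = some y := by rw [List.getLast?_reverse, hv]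
      rw [e] at hB1
      refine keyc ((A ++ [x]) ++ ((C ++ [u]).reverse ++ (v :: D))) ?_ ?_
      · obtain ⟨hC, -, hD⟩ := List.isChain_append_cons_cons.1 hB1
        refine List.isChain_append.2 ⟨hA1, List.isChain_append.2 ⟨List.isChain_reverse.2
          (hC.imp fun _ _ => Adj.symm), hD, ?_⟩, ?_⟩
        · rw [hr]
          simpa using hadj.2
        · simpa using hadj.1
      · rw [e, List.append_cons C u (v :: D)]
        exact ((C ++ [u]).reverse_perm.append_right _).append_left _
    · simp only [decide_eq_false_iff_not]
      intro hadj
      have hh : (y :: B).reverse.head? = some ((y :: B).getLast (by simp)) := by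
        rw [List.head?_reverse, List.getLast?_eq_getLast_of_ne_nil]
      refine keyc ((A ++ [x]) ++ (y :: B).reverse) ?_ ((y :: B).reverse_perm.append_left _)
      rw [List.isChain_append]
      refine ⟨hA1, hB.reverse.1, ?_⟩
      intro u hu v hv
      rw [hh] at hv
      simp at hu hv
      subst hu hv
      exact hadj
  have h3 : (A ++ [x]).countP (G.Adj y ·) = (A ++ [x]).tail.countP (G.Adj y ·) := by
    obtain ⟨a, t, e⟩ : ∃ a t, A ++ [x] = a :: t := List.exists_cons_of_ne_nil (by simp)
    rw [e, List.countP_cons]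
    suffices ¬ G.Adj y a by simp [this]
    intro hadj
    refine keyc ((A ++ [x]).reverse ++ (y :: B)) ?_ ((A ++ [x]).reverse_perm.append_right _)
    rw [List.isChain_append]
    refine ⟨hA.reverse.1, hB1, ?_⟩
    rw [e]
    simp [hadj.symm]
  have h4 : (y :: B).countP (G.Adj y ·) = (y :: B).tail.countP (G.Adj y ·) := by
    simp
  omega

/-- Two disjoint paths with ends `x` and `y` satisfying `d(x) + d(y) ≥ n - 1` can be replaced
by a single path that is at least as long as both together. -/
theorem exists_pathList_of_degree_add_degree [Fintype V] [DecidableRel G.Adj] {A B : List V}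
    {x y : V} (hA : G.IsPathList (A ++ [x])) (hB : G.IsPathList (y :: B))
    (hd : (A ++ [x]).Disjoint (y :: B)) (h : Fintype.card V - 1 ≤ G.degree x + G.degree y) :
    ∃ L, G.IsPathList L ∧ (A ++ [x]).length + (y :: B).length ≤ L.length := by
  classical
  by_cases hz : ∃ z, z ∉ A ++ [x] ∧ z ∉ y :: B ∧ G.Adj x z ∧ G.Adj y z
  · obtain ⟨z, hzA, hzB, hxz, hyz⟩ := hz
    refine ⟨(A ++ [x]) ++ ([z] ++ (y :: B)), hA.append ((isPathList_singleton z).append hB ?_ ?_)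
      ?_ ?_, by simp; omega⟩
    · simpa using hzB
    · simpa using hyz.symm
    · rw [List.disjoint_append_right]
      exact ⟨by simpa using hzA, hd⟩
    · simpa using hxz
  push Not at hz
  -- Outside the two paths N(x) and N(y) are now disjoint, so together they have at most n - |Q|
  -- vertices there. At least |Q| - 1 adjacencies remain on `Q`, just enough for the strict bound.
  apply exists_pathList_of_not_countP_le hA hB hd
  set Q := (A ++ [x]) ++ (y :: B) with hQ
  have hQn : Q.Nodup := hA.2.append hB.2 hd
  have hc : ∀ v, Q.countP (G.Adj v ·) = (Q.toFinset ∩ G.neighborFinset v).card := fun v => by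
    rw [← hQn.countP_mem_eq_card]
    simp
  have hsplit : ∀ v, G.degree v =
      (Q.toFinset ∩ G.neighborFinset v).card + (G.neighborFinset v \ Q.toFinset).card := fun v => by
    rw [← G.card_neighborFinset_eq_degree, Finset.inter_comm, Finset.card_inter_add_card_sdiff]
  have hdis : Disjoint (G.neighborFinset x \ Q.toFinset) (G.neighborFinset y \ Q.toFinset) := by
    rw [Finset.disjoint_left]
    intro z
    simp only [Finset.mem_sdiff, mem_neighborFinset, List.mem_toFinset, hQ, List.mem_append]
    rintro ⟨h1, h2⟩ ⟨h3, -⟩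
    push Not at h2
    exact hz z (by simpa using h2.1) (by simpa using h2.2) h1 h3
  have hle : (G.neighborFinset x \ Q.toFinset).card + (G.neighborFinset y \ Q.toFinset).card
      + Q.length ≤ Fintype.card V := by
    rw [← Finset.card_union_of_disjoint hdis, ← List.toFinset_card_of_nodup hQn,
      ← Finset.card_union_of_disjoint]
    · exact Finset.card_le_univ _
    · rw [← Finset.union_sdiff_distrib]
      exact Finset.sdiff_disjoint
  have hl : Q.length = (A ++ [x]).length + (y :: B).length := List.length_append
  have hl2 : 2 ≤ Q.length := by simp [hQ]; omega
  have hx := hc x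
  have hy := hc y
  rw [hQ, List.countP_append, ← hQ] at hx hy
  have := hsplit x
  have := hsplit y
  omega

end SimpleGraph

/-! ### Longest paths in claw-heavy graphs -/

namespace SimpleGraph

variable {V : Type*} {G : SimpleGraph V}

/-- A path list of maximum length. -/
def IsLongestPathList (G : SimpleGraph V) (l : List V) : Prop :=
  G.IsPathList l ∧ ∀ m, G.IsPathList m → m.length ≤ l.length

theorem exists_isLongestPathList [Fintype V] (G : SimpleGraph V) :
    ∃ l, G.IsLongestPathList l := by
  have hb : ∀ n, (∃ l, G.IsPathList l ∧ l.length = n) → n ≤ Fintype.card V := by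
    rintro n ⟨l, hl, rfl⟩
    exact hl.2.length_le_card
  have h0 : ∃ n, ∃ l, G.IsPathList l ∧ l.length = n := ⟨0, [], ⟨.nil, .nil⟩, rfl⟩
  classical
  obtain ⟨n, hn⟩ := h0
  obtain ⟨l, hl, he⟩ := Nat.findGreatest_spec (P := fun n => ∃ l, G.IsPathList l ∧ l.length = n)
    (hb n hn) hn
  exact ⟨l, hl, fun m hm => he ▸ Nat.le_findGreatest (hb _ ⟨m, hm, rfl⟩) ⟨m, hm, rfl⟩⟩

theorem IsLongestPathList.reverse {l : List V} (h : G.IsLongestPathList l) :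
    G.IsLongestPathList l.reverse :=
  ⟨h.1.reverse, fun m hm => by simpa using h.2 m hm⟩

theorem IsLongestPathList.ne_nil [Nonempty V] {l : List V} (h : G.IsLongestPathList l) :
    l ≠ [] := by
  rintro rfl
  simpa using h.2 [Classical.arbitrary V] (isPathList_singleton _)

theorem IsLongestPathList.not_adj_head {l : List V} {x v : V} (h : G.IsLongestPathList (v :: l))
    (hx : x ∉ v :: l) : ¬ G.Adj x v := fun hadj => by
  have := h.2 (x :: v :: l) ⟨.cons_cons hadj h.1.1, List.nodup_cons.2 ⟨hx, h.1.2⟩⟩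
  simp at this

theorem IsLongestPathList.not_adj_last {l : List V} {x v : V} (h : G.IsLongestPathList (l ++ [v]))
    (hx : x ∉ l ++ [v]) : ¬ G.Adj x v := by
  have := h.reverse
  rw [List.reverse_append] at this
  exact this.not_adj_head (by simpa [or_comm] using hx)

variable [Fintype V] [DecidableRel G.Adj]

/-- The degree sum of `x` and `y` is at least `n - 1`. -/
def IsHeavyPair (G : SimpleGraph V) [DecidableRel G.Adj] (x y : V) : Prop :=
  Fintype.card V - 1 ≤ G.degree x + G.degree y

theorem IsHeavyPair.symm {x y : V} (h : G.IsHeavyPair x y) : G.IsHeavyPair y x := by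
  unfold IsHeavyPair at h ⊢
  rwa [Nat.add_comm]

theorem IsLongestPathList.length_le {l A B : List V} {x y : V} (h : G.IsLongestPathList l)
    (hA : G.IsPathList (A ++ [x])) (hB : G.IsPathList (y :: B))
    (hd : (A ++ [x]).Disjoint (y :: B)) (hxy : G.Adj x y ∨ G.IsHeavyPair x y) :
    (A ++ [x]).length + (y :: B).length ≤ l.length := by
  rcases hxy with hxy | hxy
  · rw [← List.length_append]
    exact h.2 _ (hA.append hB hd (by simpa using hxy))
  · obtain ⟨L, hL, hle⟩ := exists_pathList_of_degree_add_degree hA hB hd hxy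
    exact hle.trans (h.2 L hL)

/-- Otherwise x could be inserted between c and its successor b, a heavy pair replacing the edge if
necessary. -/
theorem IsLongestPathList.not_insert {A B : List V} {x b c : V}
    (h : G.IsLongestPathList (A ++ c :: b :: B)) (hx : x ∉ A ++ c :: b :: B) (hxc : G.Adj x c) :
    ¬ (G.Adj x b ∨ G.IsHeavyPair x b) := fun hb => by
  have h1 := h.1
  rw [List.append_cons] at h1
  have hx' : x ∉ A ++ [c] ∧ x ∉ b :: B := by
    rw [List.append_cons, List.mem_append] at hx
    exact not_or.1 hx
  have := h.length_le (A := A ++ [c]) (x := x)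
    (h1.left.append (isPathList_singleton x) (by simpa using hx'.1) (by simpa using hxc.symm))
    h1.right (by
      rw [List.disjoint_append_left]
      exact ⟨List.disjoint_of_nodup_append h1.2, by simpa using hx'.2⟩) hb
  simp at this
  omega

/-- Otherwise start at x, enter at c, walk back to the first vertex v, and continue from v to b. -/
theorem IsLongestPathList.not_rotate {A B : List V} {x b c v : V}
    (h : G.IsLongestPathList (v :: A ++ c :: b :: B)) (hx : x ∉ v :: A ++ c :: b :: B)
    (hxc : G.Adj x c) : ¬ (G.Adj v b ∨ G.IsHeavyPair v b) := fun hb => by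
  have h1 := h.1
  rw [List.append_cons] at h1
  have hx' : x ∉ v :: A ++ [c] ∧ x ∉ b :: B := by
    rw [List.append_cons, List.mem_append] at hx
    exact not_or.1 hx
  have h2 : G.IsPathList ([x] ++ (v :: A ++ [c]).reverse) :=
    (isPathList_singleton x).append h1.left.reverse
      (by rw [List.singleton_disjoint, List.mem_reverse]; exact hx'.1) (by simpa using hxc)
  have e : [x] ++ (v :: A ++ [c]).reverse = ([x, c] ++ A.reverse) ++ [v] := by simp
  rw [e] at h2
  have := h.length_le h2 h1.right (by
      rw [← e, List.disjoint_append_left, List.singleton_disjoint, List.disjoint_reverse_left]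
      exact ⟨hx'.2, List.disjoint_of_nodup_append h1.2⟩) hb
  simp at this
  omega

/-- Every induced claw contains a heavy pair of leaves. -/
def IsClawHeavy (G : SimpleGraph V) [DecidableRel G.Adj] : Prop :=
  ∀ c x y z, G.Adj c x → G.Adj c y → G.Adj c z → x ≠ y → x ≠ z → y ≠ z →
    ¬ G.Adj x y → ¬ G.Adj x z → ¬ G.Adj y z →
    G.IsHeavyPair x y ∨ G.IsHeavyPair x z ∨ G.IsHeavyPair y z

/-- If z were a common neighbour on the path with successor b, then x, v, b would be the leaves of a
claw at z, and a heavy pair among them would give a longer path. If z were off the path, it would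
extend the path at v. -/
theorem IsLongestPathList.no_common_neighbor_head (H : G.IsClawHeavy) {l : List V} {x v z : V}
    (h : G.IsLongestPathList (v :: l)) (hx : x ∉ v :: l) (hxz : G.Adj x z) : ¬ G.Adj v z := by
  intro hvz
  by_cases hz : z ∈ l
  · obtain ⟨A, B, rfl⟩ := List.append_of_mem hz
    cases B with
    | nil => exact IsLongestPathList.not_adj_last (l := v :: A) h hx hxz
    | cons b B =>
      have hxb := h.not_insert (A := v :: A) hx hxz
      have hvb := h.not_rotate hx hxz
      have hvx := h.not_adj_head hx
      have hnd := h.1.2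
      have hzb : G.Adj z b := ((List.isChain_append_cons_cons (l₁ := v :: A)).1 h.1.1).2.1
      have hne : x ≠ v := fun e => hx (by simp [e])
      have hne2 : x ≠ b := fun e => hx (by simp [e])
      have hne3 : v ≠ b := by
        rintro rfl
        simp at hnd
      rcases H z x v b hxz.symm hvz.symm hzb hne hne2 hne3 hvx (not_or.1 hxb).1 (not_or.1 hvb).1
        with h1 | h1 | h1
      · have := h.length_le (A := []) (isPathList_singleton x) h.1 (by simpa using hx) (.inr h1)
        simp at this
      · exact hxb (.inr h1)
      · exact hvb (.inr h1)
  · have hzl : z ∉ v :: l := by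
      rw [List.mem_cons, not_or]
      exact ⟨hvz.ne', hz⟩
    exact h.not_adj_head hzl hvz.symm

theorem IsLongestPathList.no_common_neighbor_last (H : G.IsClawHeavy) {l : List V} {x v z : V}
    (h : G.IsLongestPathList (l ++ [v])) (hx : x ∉ l ++ [v]) (hxz : G.Adj x z) :
    ¬ G.Adj v z := by
  have := h.reverse
  rw [List.reverse_append] at this
  exact this.no_common_neighbor_head H (by simpa [or_comm] using hx) hxz

/-- A claw-heavy graph of diameter at most two is traceable. -/
theorem IsClawHeavy.isTraceable_of_common_neighbor [Nonempty V] (H : G.IsClawHeavy)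
    (hG : ∀ x y, x ≠ y → ¬ G.Adj x y → ∃ z, G.Adj x z ∧ G.Adj y z) : G.IsTraceable := by
  obtain ⟨l, hl⟩ := G.exists_isLongestPathList
  refine hl.1.isTraceable hl.ne_nil fun x => ?_
  by_contra hx
  obtain ⟨v, t, rfl⟩ := List.exists_cons_of_ne_nil hl.ne_nil
  obtain ⟨z, hxz, hvz⟩ := hG x v (fun e => hx (by simp [e])) (hl.not_adj_head hx)
  exact hl.no_common_neighbor_head H hx hxz hvz

theorem Connected.exists_adj_of_notMem {V : Type*} {G : SimpleGraph V} (hG : G.Connected)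
    {l : List V} (hne : l ≠ []) {x : V} (hx : x ∉ l) : ∃ y c, y ∉ l ∧ c ∈ l ∧ G.Adj y c := by
  obtain ⟨v, hv⟩ := List.exists_mem_of_ne_nil l hne
  obtain ⟨p⟩ := hG.preconnected v x
  obtain ⟨d, -, h1, h2⟩ := p.exists_boundary_dart {w | w ∈ l} hv hx
  exact ⟨d.snd, d.fst, h2, h1, d.adj.symm⟩

/-- In a connected graph in which every two vertices at distance at most three are at distance
at most two, the same holds for all pairs of vertices. -/
theorem Connected.exists_common_neighbor {V : Type*} {G : SimpleGraph V} (hG : G.Connected)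
    (h : ∀ x u z w, G.Adj x u → G.Adj u z → G.Adj z w → x ≠ z → x ≠ w → u ≠ w →
      ¬ G.Adj x z → ¬ G.Adj x w → ¬ G.Adj u w → ∃ t, G.Adj x t ∧ G.Adj w t)
    (x y : V) (hxy : x ≠ y) (hadj : ¬ G.Adj x y) : ∃ z, G.Adj x z ∧ G.Adj y z := by
  suffices x = y ∨ G.Adj x y ∨ ∃ z, G.Adj x z ∧ G.Adj y z by tauto
  have hr := (reachable_iff_reflTransGen x y).1 (hG.preconnected x y)
  clear hxy hadj
  induction hr with
  | refl => exact .inl rfl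
  | @tail z w hz hzw ih =>
    rcases ih with rfl | hxz | ⟨u, hxu, hzu⟩
    · exact .inr (.inl hzw)
    · exact .inr (.inr ⟨z, hxz, hzw.symm⟩)
    · by_cases h1 : x = w
      · exact .inl h1
      by_cases h2 : G.Adj x w
      · exact .inr (.inl h2)
      refine .inr (.inr ?_)
      by_cases h3 : G.Adj u w
      · exact ⟨u, hxu, h3.symm⟩
      by_cases h4 : x = z
      · exact absurd (h4 ▸ hzw) h2
      by_cases h5 : G.Adj x z
      · exact ⟨z, h5, hzw.symm⟩
      by_cases h6 : u = w
      · exact absurd (h6 ▸ hxu) h2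
      exact h x u z w hxu hzu.symm hzw h4 h1 h6 h5 h2 h3

end SimpleGraph

/-! ### Triangle-free graphs -/

namespace SimpleGraph

variable {V : Type*} {G : SimpleGraph V} [Fintype V] [DecidableRel G.Adj]

/-- Three neighbours of b are the leaves of a claw; t is the vertex of larger degree in its heavy
pair. -/
theorem exists_adj_two_mul_degree (H : G.IsClawHeavy)
    (ht : ∀ a b c, G.Adj a b → G.Adj b c → ¬ G.Adj a c) {b : V} (hb : 2 < G.degree b) :
    ∃ t, G.Adj b t ∧ Fintype.card V - 1 ≤ 2 * G.degree t := by
  rw [← G.card_neighborFinset_eq_degree, Finset.two_lt_card] at hb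
  obtain ⟨r, hr, s, hs, t, ht', hrs, hrt, hst⟩ := hb
  rw [mem_neighborFinset] at hr hs ht'
  have key : ∀ r s, G.Adj b r → G.Adj b s → G.IsHeavyPair r s →
      ∃ t, G.Adj b t ∧ Fintype.card V - 1 ≤ 2 * G.degree t := by
    intro r s hr hs h
    unfold IsHeavyPair at h
    rcases le_total (G.degree r) (G.degree s) with hle | hle
    · exact ⟨s, hs, by omega⟩
    · exact ⟨r, hr, by omega⟩
  rcases H b r s t hr hs ht' hrs hrt hst (ht _ _ _ hr.symm hs) (ht _ _ _ hr.symm ht')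
    (ht _ _ _ hs.symm ht') with h | h | h
  · exact key _ _ hr hs h
  · exact key _ _ hr ht' h
  · exact key _ _ hs ht' h

/-- If `b` and `t` are adjacent vertices of a triangle-free graph of degree at least `(n - 1) / 2`
and `w` is adjacent to neither of them, then all other vertices are adjacent to `b` or `t`. -/
theorem adj_or_adj_of_two_mul_degree (ht : ∀ a b c, G.Adj a b → G.Adj b c → ¬ G.Adj a c)
    {b t w : V} (hbt : G.Adj b t) (hb : Fintype.card V - 1 ≤ 2 * G.degree b)
    (hd : Fintype.card V - 1 ≤ 2 * G.degree t) (hwb : ¬ G.Adj b w) (hwt : ¬ G.Adj t w) :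
    (∀ y, y ≠ w → G.Adj b y ∨ G.Adj t y) ∧ 2 * G.degree b + 1 = Fintype.card V ∧
      G.degree t = G.degree b := by
  classical
  have hdis : Disjoint (G.neighborFinset b) (G.neighborFinset t) := by
    rw [Finset.disjoint_left]
    intro z hz hz'
    rw [mem_neighborFinset] at hz hz'
    exact ht _ _ _ hbt hz' hz
  have hsub : G.neighborFinset b ∪ G.neighborFinset t ⊆ Finset.univ.erase w := by
    intro z hz
    rw [Finset.mem_union, mem_neighborFinset, mem_neighborFinset] at hz
    refine Finset.mem_erase.2 ⟨?_, Finset.mem_univ _⟩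
    rintro rfl
    tauto
  have hc := Finset.card_le_card hsub
  have hcu := Finset.card_union_of_disjoint hdis
  have he : (Finset.univ.erase w).card = Fintype.card V - 1 := by
    rw [Finset.card_erase_of_mem (Finset.mem_univ _), Finset.card_univ]
  have hpos : 0 < Fintype.card V := Fintype.card_pos_iff.2 ⟨w⟩
  simp only [card_neighborFinset_eq_degree] at hcu
  refine ⟨fun y hy => ?_, by omega, by omega⟩
  have := Finset.eq_of_subset_of_card_le hsub (by omega)
  have hy' : y ∈ Finset.univ.erase w := Finset.mem_erase.2 ⟨hy, Finset.mem_univ _⟩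
  rw [← this] at hy'
  simpa using hy'

/-- The case in which the vertex `x` off the longest path is adjacent to neither `b` nor `t`. -/
theorem IsLongestPathList.false_of_not_adj (H : G.IsClawHeavy)
    (ht : ∀ a b c, G.Adj a b → G.Adj b c → ¬ G.Adj a c) {T P : List V} {v p a b c t x : V}
    (hP : G.IsLongestPathList (v :: T)) (hP' : v :: T = P ++ [p]) (hx : x ∉ v :: T)
    (hxc : G.Adj x c) (hac : G.Adj a c) (hcP : c ∈ v :: T) (ha : a ∈ v :: T) (hxa : ¬ G.Adj x a)
    (hba : ¬ G.Adj b a) (hvb : ¬ G.Adj b v) (hpa : ¬ G.Adj a p) (hbx : ¬ G.Adj b x)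
    (hadj : ∀ y, y ≠ x → G.Adj b y ∨ G.Adj t y)
    (hcard : 2 * G.degree b + 1 = Fintype.card V) (hdt : G.degree t = G.degree b)
    (hda : G.degree b ≤ G.degree a) : False := by
  classical
  have hne : ∀ y ∈ v :: T, y ≠ x := fun y hy e => hx (e ▸ hy)
  have hpP : p ∈ v :: T := by simp [hP']
  have hnd := hP.1.2
  have hcv : ∀ {z y}, y ∉ v :: T → G.Adj y z → ¬ G.Adj v z := fun hy h =>
    hP.no_common_neighbor_head H hy h
  have hcp : ∀ {z y}, y ∉ v :: T → G.Adj y z → ¬ G.Adj p z := fun hy h => by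
    rw [hP'] at hP hy
    exact hP.no_common_neighbor_last H hy h
  have hta : G.Adj t a := (hadj a (hne a ha)).resolve_left hba
  have htv : G.Adj t v := (hadj v (hne v (by simp))).resolve_left hvb
  -- a lies in N(t) and misses x, so N(a) ⊆ N(b); the degrees force equality.
  have hab : ∀ y, G.Adj a y ↔ G.Adj b y := by
    have hsub : G.neighborFinset a ⊆ G.neighborFinset b := by
      intro y hy
      rw [mem_neighborFinset] at hy ⊢
      refine (hadj y ?_).resolve_right fun h => ht _ _ _ hta hy h
      rintro rfl
      exact hxa hy.symm
    have := Finset.eq_of_subset_of_card_le hsub (by simpa using hda)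
    intro y
    rw [← mem_neighborFinset, this, mem_neighborFinset]
  have hbp : ¬ G.Adj b p := fun h => hpa ((hab p).2 h)
  have htp : G.Adj t p := (hadj p (hne p hpP)).resolve_left hbp
  have hTne : T ≠ [] := by
    rintro rfl
    simp only [List.mem_singleton] at ha hpP
    exact hcv hx hxc (ha ▸ hac)
  have hvp : v ≠ p := by
    have h1 : T.getLast hTne = p := by
      have := congrArg List.getLast? hP'
      rw [List.getLast?_cons_of_ne_nil hTne, List.getLast?_eq_getLast_of_ne_nil hTne] at this
      simpa using this
    rintro rfl
    exact (List.nodup_cons.1 hnd).1 (Eq.subst (motive := (· ∈ T)) h1 (List.getLast_mem hTne))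
  -- On the path every neighbour of b is followed by a neighbour of t, and p is not a neighbour of
  -- b. If N(b) lay on the path, then d(b) ≤ d(t) - 1, because v ∈ N(t) has no predecessor.
  obtain ⟨u, hu, hbu⟩ : ∃ u, u ∉ v :: T ∧ G.Adj b u := by
    by_contra hno
    push Not at hno
    have h1 := List.countP_le_countP_tail (fun y => decide (y ∈ G.neighborFinset b))
      (fun y => decide (y ∈ insert x (G.neighborFinset t))) (l := v :: T) (by simp)
      (hP.1.1.imp fun y z hyz => by
        simp only [decide_eq_true_eq, Finset.mem_insert, mem_neighborFinset]
        intro hby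
        by_cases hz : z = x
        · exact .inl hz
        · exact .inr ((hadj z hz).resolve_left fun h => ht _ _ _ hby hyz h)) (by
        simp only [hP', List.getLast_append_singleton]
        simpa using hbp)
    rw [hnd.countP_mem_eq_card, List.tail_cons, (List.nodup_cons.1 hnd).2.countP_mem_eq_card] at h1
    have h2 : (v :: T).toFinset ∩ G.neighborFinset b = G.neighborFinset b := by
      rw [Finset.inter_eq_right]
      intro y hy
      rw [mem_neighborFinset] at hy
      by_contra h
      exact hno y (by simpa using h) hy
    have h3 : T.toFinset ∩ insert x (G.neighborFinset t) ⊆ (G.neighborFinset t).erase v := by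
      intro y hy
      rw [Finset.mem_inter, Finset.mem_insert, List.mem_toFinset] at hy
      refine Finset.mem_erase.2 ⟨?_, hy.2.resolve_left (hne y (List.mem_cons_of_mem _ hy.1))⟩
      rintro rfl
      exact (List.nodup_cons.1 hnd).1 hy.1
    have h4 := Finset.card_le_card h3
    rw [Finset.card_erase_of_mem (by simpa using htv), card_neighborFinset_eq_degree] at h4
    rw [h2, card_neighborFinset_eq_degree] at h1
    have : 0 < G.degree t := (G.degree_pos_iff_exists_adj t).2 ⟨v, htv⟩
    omega
  obtain ⟨v₂, T', rfl⟩ := List.exists_cons_of_ne_nil hTne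
  have hvv : G.Adj v v₂ := hP.1.1.rel
  have hbv : G.Adj b v₂ := (hadj v₂ (hne _ (by simp))).resolve_right fun h => ht _ _ _ htv hvv h
  have hbc : G.Adj b c := (hab c).1 hac
  have hbb : ∀ {y z}, G.Adj b y → G.Adj b z → ¬ G.Adj y z := fun hy hz => ht _ _ _ hy.symm hz
  have hsmall : ∀ y, G.Adj b y → ¬ G.Adj y v → ¬ G.Adj y p → G.degree y + 1 ≤ G.degree b := by
    intro y hy hyv hyp
    have hsub : G.neighborFinset y ⊆ insert x (((G.neighborFinset t).erase v).erase p) := by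
      intro z hz
      rw [mem_neighborFinset] at hz
      rw [Finset.mem_insert, Finset.mem_erase, Finset.mem_erase, mem_neighborFinset]
      by_cases hzx : z = x
      · exact .inl hzx
      · refine .inr ⟨?_, ?_, (hadj z hzx).resolve_left fun h => ht _ _ _ hy hz h⟩
        · rintro rfl
          exact hyp hz
        · rintro rfl
          exact hyv hz
    have h1 := (Finset.card_le_card hsub).trans (Finset.card_insert_le _ _)
    have h2 : ((G.neighborFinset t).erase v).card + 1 = G.degree t := by
      rw [Finset.card_erase_add_one (by simpa using htv), card_neighborFinset_eq_degree]
    have h3 : (((G.neighborFinset t).erase v).erase p).card + 1 =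
        ((G.neighborFinset t).erase v).card :=
      Finset.card_erase_add_one (Finset.mem_erase.2 ⟨hvp.symm, by simpa using htp⟩)
    rw [card_neighborFinset_eq_degree] at h1
    omega
  have hdu := hsmall u hbu (hP.not_adj_head hu) (by
    rw [hP'] at hP hu
    exact hP.not_adj_last hu)
  have hdc := hsmall c hbc (fun h => hcv hx hxc h.symm) (fun h => hcp hx hxc h.symm)
  have hdv : G.degree v₂ ≤ G.degree b := by
    rw [← hdt, ← card_neighborFinset_eq_degree, ← card_neighborFinset_eq_degree]
    refine Finset.card_le_card fun y hy => ?_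
    rw [mem_neighborFinset] at hy ⊢
    refine (hadj y ?_).resolve_left fun h => ht _ _ _ hbv hy h
    rintro rfl
    exact hcv hx hy.symm hvv
  have huc : u ≠ c := by
    rintro rfl
    exact hu hcP
  have huv : u ≠ v₂ := by
    rintro rfl
    simp at hu
  have hcv₂ : c ≠ v₂ := by
    rintro rfl
    exact hcv hx hxc hvv
  -- In this claw u and c have degree at most d(b) - 1, as they miss both ends v and p, and v₂ has
  -- degree at most d(b). No pair reaches n - 1 = 2d(b).
  rcases H a u c v₂ ((hab u).2 hbu) hac ((hab v₂).2 hbv) huc huv hcv₂ (hbb hbu hbc) (hbb hbu hbv)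
    (hbb hbc hbv) with h | h | h <;> unfold IsHeavyPair at h <;> omega

/-- The case in which the vertex `x` off the longest path is adjacent to `t`. -/
theorem IsLongestPathList.false_of_adj (H : G.IsClawHeavy)
    (ht : ∀ a b c, G.Adj a b → G.Adj b c → ¬ G.Adj a c) {A B T P : List V} {v p a b c t x : V}
    (hP : G.IsLongestPathList (v :: T)) (hP' : v :: T = P ++ [p])
    (hT : T = A ++ a :: c :: b :: B) (hx : x ∉ v :: T)
    (hxc : G.Adj x c) (hba : ¬ G.Adj b a) (hvb : ¬ G.Adj b v) (hpa : ¬ G.Adj a p)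
    (htx : G.Adj t x)
    (hadj : ∀ y, y ≠ v → G.Adj b y ∨ G.Adj t y) (hdt : G.degree t = G.degree b)
    (hda : G.degree b ≤ G.degree a) : False := by
  classical
  have hne : ∀ y ∈ v :: T, y ≠ x := fun y hy e => hx (e ▸ hy)
  have hnd := hP.1.2
  have hTv : ∀ y ∈ T, y ≠ v := fun y hy e => (List.nodup_cons.1 hnd).1 (e ▸ hy)
  have hcp : ∀ {z y}, y ∉ v :: T → G.Adj y z → ¬ G.Adj p z := fun hy h => by
    rw [hP'] at hP hy
    exact hP.no_common_neighbor_last H hy h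
  have hTne : T ≠ [] := by
    rintro rfl
    simp at hT
  have haT : a ∈ T := by simp [hT]
  have hpT : p ∈ T := by
    have := congrArg List.getLast? hP'
    rw [List.getLast?_cons_of_ne_nil hTne, List.getLast?_eq_getLast_of_ne_nil hTne] at this
    have h1 : T.getLast hTne = p := by simpa using this
    exact h1 ▸ List.getLast_mem hTne
  have hbp : G.Adj b p :=
    (hadj p (hTv p hpT)).resolve_right fun h => hcp hx htx.symm h.symm
  have hbP : ∀ u, G.Adj b u → u ∈ v :: T := fun u hu => by
    by_contra h
    exact hcp h hu.symm hbp.symm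
  have hta : G.Adj t a := (hadj a (hTv a haT)).resolve_left hba
  have hNa : G.neighborFinset a = insert v ((G.neighborFinset b).erase p) := by
    refine Finset.eq_of_subset_of_card_le (fun y hy => ?_) ?_
    · rw [mem_neighborFinset] at hy
      rw [Finset.mem_insert, Finset.mem_erase, mem_neighborFinset]
      by_cases hyv : y = v
      · exact .inl hyv
      · refine .inr ⟨?_, (hadj y hyv).resolve_right fun h => ht _ _ _ hta hy h⟩
        rintro rfl
        exact hpa hy
    · refine (Finset.card_insert_le _ _).trans ?_
      rw [Finset.card_erase_add_one (by simpa using hbp)]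
      simpa using hda
  have hav : G.Adj a v := by
    rw [← mem_neighborFinset, hNa]
    exact Finset.mem_insert_self _ _
  -- If a were second on the path, all of N(b) would come after a. Each such vertex is preceded by a
  -- neighbour of t on the path, and x ∈ N(t) is off it, so d(b) ≤ d(t) - 1.
  have hA : A ≠ [] := by
    rintro rfl
    have h1 := List.countP_tail_le_countP (fun y => decide (y ∈ G.neighborFinset b))
      (fun y => decide (y ∈ insert v (G.neighborFinset t))) (l := T)
      (hP.1.1.of_cons.imp fun y z hyz => by
        simp only [decide_eq_true_eq, Finset.mem_insert, mem_neighborFinset]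
        intro hbz
        by_cases hy : y = v
        · exact .inl hy
        · exact .inr ((hadj y hy).resolve_left fun h => ht _ _ _ h hyz hbz))
    have hndT := (List.nodup_cons.1 hnd).2
    rw [hndT.countP_mem_eq_card, hndT.tail.countP_mem_eq_card] at h1
    have h2 : T.tail.toFinset ∩ G.neighborFinset b = G.neighborFinset b := by
      rw [Finset.inter_eq_right]
      intro y hy
      rw [mem_neighborFinset] at hy
      have := hbP y hy
      rw [hT] at this ⊢
      simp only [List.nil_append, List.mem_cons, List.tail_cons, List.mem_toFinset] at this ⊢
      rcases this with rfl | rfl | h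
      · exact absurd hy hvb
      · exact absurd hy hba
      · exact h
    have h3 : T.toFinset ∩ insert v (G.neighborFinset t) ⊆ (G.neighborFinset t).erase x := by
      intro y hy
      rw [Finset.mem_inter, Finset.mem_insert, List.mem_toFinset] at hy
      exact Finset.mem_erase.2 ⟨hne y (List.mem_cons_of_mem _ hy.1), hy.2.resolve_left (hTv y hy.1)⟩
    have h4 := Finset.card_le_card h3
    rw [Finset.card_erase_of_mem (by simpa using htx), card_neighborFinset_eq_degree] at h4
    rw [h2, card_neighborFinset_eq_degree] at h1
    have : 0 < G.degree t := (G.degree_pos_iff_exists_adj t).2 ⟨x, htx⟩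
    omega
  obtain ⟨A, e, rfl⟩ := (List.eq_nil_or_concat' A).resolve_left hA
  have hch := hP.1.1
  have e1 : v :: T = (v :: A) ++ e :: a :: (c :: b :: B) := by simp [hT]
  rw [e1] at hch
  obtain ⟨hch1, hea, hch2⟩ := List.isChain_append_cons_cons.1 hch
  have heT : e ∈ T := by simp [hT]
  have hbe : G.Adj b e := (hadj e (hTv e heT)).resolve_right fun h => ht _ _ _ h hea hta
  have hca : G.Adj c a := hch2.rel.symm
  -- The edges av and eb reroute the path so that it starts x, c, a and gains the vertex x.
  have hL : G.IsPathList ([x, c, a] ++ ((v :: A ++ [e]) ++ b :: B)) := by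
    refine ⟨?_, ?_⟩
    · refine List.isChain_append.2 ⟨by simp [hxc, hca], List.isChain_append.2
        ⟨hch1, hch2.of_cons.of_cons, by rw [List.getLast?_concat]; simpa using hbe.symm⟩, by simpa using hav⟩
    · have h1 : (x :: v :: T).Nodup := List.nodup_cons.2 ⟨hx, hnd⟩
      refine List.Perm.nodup (List.Perm.cons x ?_) h1
      rw [e1, List.append_cons]
      exact ((List.Perm.swap c a _).append_left _).trans
        (List.perm_append_comm_assoc (v :: A ++ [e]) [c, a] (b :: B))
  have := hP.2 _ hL
  rw [e1] at this
  simp at this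
  omega

/-- A connected triangle-free graph in which every induced claw contains a heavy pair is
traceable. -/
theorem IsClawHeavy.isTraceable_of_triangleFree (H : G.IsClawHeavy) (hG : G.Connected)
    (ht : ∀ a b c, G.Adj a b → G.Adj b c → ¬ G.Adj a c) : G.IsTraceable := by
  classical
  have := hG.nonempty
  obtain ⟨l, hl⟩ := G.exists_isLongestPathList
  refine hl.1.isTraceable hl.ne_nil fun x₀ => ?_
  by_contra hx₀
  obtain ⟨x, c, hx, hc, hxc⟩ := hG.exists_adj_of_notMem hl.ne_nil hx₀
  clear hx₀ x₀
  obtain ⟨A, B, rfl⟩ := List.append_of_mem hc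
  have hA : A ≠ [] := by
    rintro rfl
    exact hl.not_adj_head hx hxc
  have hB : B ≠ [] := by
    rintro rfl
    exact hl.not_adj_last hx hxc
  obtain ⟨A, a, rfl⟩ := (List.eq_nil_or_concat' A).resolve_left hA
  obtain ⟨b, B, rfl⟩ := List.exists_cons_of_ne_nil hB
  have key : ∀ A B a b, G.IsLongestPathList (A ++ a :: c :: b :: B) → x ∉ A ++ a :: c :: b :: B →
      G.IsHeavyPair a b → G.degree a ≤ G.degree b → False := by
    clear hA hB hl hx hc A B a b
    intro A B a b hl hx hab hle
    have hac : G.Adj a c := (List.isChain_append_cons_cons.1 hl.1.1).2.1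
    have hcb : G.Adj c b := (List.isChain_append_cons_cons.1 hl.1.1).2.2.rel
    have e1 : A ++ a :: c :: b :: B = (A ++ [a]) ++ c :: b :: B := by simp
    have e2 : (A ++ a :: c :: b :: B).reverse = (B.reverse ++ [b]) ++ c :: a :: A.reverse := by simp
    have hr := hl.reverse
    have hxr : x ∉ (A ++ a :: c :: b :: B).reverse := by rwa [List.mem_reverse]
    rw [e2] at hr hxr
    have hxb : ¬ G.Adj x b := fun h => (e1 ▸ hl).not_insert (e1 ▸ hx) hxc (.inl h)
    have hxa : ¬ G.Adj x a := fun h => hr.not_insert hxr hxc (.inl h)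
    have hba : ¬ G.Adj b a := fun h => ht _ _ _ hcb h hac.symm
    have hA : A ≠ [] := by
      rintro rfl
      exact hl.no_common_neighbor_head H hx hxc hac
    have hB : B.reverse ≠ [] := by
      intro h
      rw [h] at hr hxr
      exact hr.no_common_neighbor_head H hxr hxc hcb.symm
    obtain ⟨v, A, rfl⟩ := List.exists_cons_of_ne_nil hA
    obtain ⟨p, B', hB'⟩ := List.exists_cons_of_ne_nil hB
    rw [hB'] at hr hxr
    have hvb : ¬ G.Adj v b := fun h =>
      IsLongestPathList.not_rotate (A := A ++ [a]) (by simpa using hl) (by simpa using hx) hxc (.inl h)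
    have hpa : ¬ G.Adj p a := fun h =>
      IsLongestPathList.not_rotate (A := B' ++ [b]) (by simpa using hr) (by simpa using hxr) hxc
        (.inl h)
    have hBp : B = B'.reverse ++ [p] := by
      rw [← List.reverse_reverse B, hB', List.reverse_cons]
    subst hBp
    -- The distinct vertices v, a, c, b, p, x give 2d(b) ≥ 5, hence three neighbours of b.
    have hn : 6 ≤ Fintype.card V := by
      have := (List.nodup_cons.2 ⟨hx, hl.1.2⟩).length_le_card
      simp at this
      omega
    have hdb : Fintype.card V - 1 ≤ 2 * G.degree b := by
      unfold IsHeavyPair at hab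
      omega
    obtain ⟨t, hbt, hdt⟩ := exists_adj_two_mul_degree H ht (b := b) (by omega)
    have hP' : v :: A ++ a :: c :: b :: (B'.reverse ++ [p]) =
      (v :: A ++ a :: c :: b :: B'.reverse) ++ [p] := by simp
    -- The single vertex missed by N(b) ∪ N(t) is v if t ~ x, since t is then no neighbour of v, and
    -- x otherwise.
    by_cases htx : G.Adj t x
    · obtain ⟨hadj, hcard, hdd⟩ := adj_or_adj_of_two_mul_degree ht hbt hdb hdt
        (fun h => hvb h.symm) (fun h => hl.no_common_neighbor_head H hx htx.symm h.symm)
      refine IsLongestPathList.false_of_adj H ht (T := A ++ a :: c :: b :: (B'.reverse ++ [p]))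
        hl hP' rfl hx hxc hba (fun h => hvb h.symm) (fun h => hpa h.symm)
        htx hadj hdd ?_
      unfold IsHeavyPair at hab
      omega
    · obtain ⟨hadj, hcard, hdd⟩ := adj_or_adj_of_two_mul_degree ht hbt hdb hdt
        (fun h => hxb h.symm) htx
      refine IsLongestPathList.false_of_not_adj H ht
        (T := A ++ a :: c :: b :: (B'.reverse ++ [p]))
        hl hP' hx hxc hac (by simp) (by simp) hxa hba (fun h => hvb h.symm) (fun h => hpa h.symm)
        (fun h => hxb h.symm) hadj hcard hdd ?_
      unfold IsHeavyPair at hab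
      omega
  have e0 : A ++ [a] ++ c :: b :: B = A ++ a :: c :: b :: B := by simp
  have e2 : (A ++ a :: c :: b :: B).reverse = (B.reverse ++ [b]) ++ c :: a :: A.reverse := by simp
  have e3 : (A ++ a :: c :: b :: B).reverse = B.reverse ++ b :: c :: a :: A.reverse := by simp
  have hr := hl.reverse
  have hxr : x ∉ (A ++ [a] ++ c :: b :: B).reverse := by rwa [List.mem_reverse]
  rw [e0] at hr hxr
  have hxb := hl.not_insert hx hxc
  have hxa := (e2 ▸ hr).not_insert (e2 ▸ hxr) hxc
  have hac : G.Adj c a := (List.isChain_append_cons_cons.1 (e0 ▸ hl.1.1)).2.1.symm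
  have hcb : G.Adj c b := (List.isChain_append_cons_cons.1 (e0 ▸ hl.1.1)).2.2.rel
  have hnd := hl.1.2
  have hab : a ≠ b := by
    rintro rfl
    simp [List.nodup_append] at hnd
  have hheavy : G.IsHeavyPair a b := by
    rcases H c x a b hxc.symm hac hcb (by rintro rfl; simp at hx) (by rintro rfl; simp at hx) hab
      (not_or.1 hxa).1 (not_or.1 hxb).1 (ht _ _ _ hac.symm hcb) with h | h | h
    · exact absurd (.inr h) hxa
    · exact absurd (.inr h) hxb
    · exact h
  rcases le_total (G.degree a) (G.degree b) with hle | hle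
  · exact key A B a b (e0 ▸ hl) (e0 ▸ hx) hheavy hle
  · exact key B.reverse A.reverse b a (e3 ▸ hr) (e3 ▸ hxr) hheavy.symm hle

end SimpleGraph

/-! ### Forbidden induced subgraphs and sufficiency -/

namespace SimpleGraph

variable {V : Type*} {G : SimpleGraph V}

theorem not_isInducedFree_iff {U : Type*} {H : SimpleGraph U} :
    ¬ G.IsInducedFree H ↔ Nonempty (H ↪g G) := by
  unfold IsInducedFree
  push Not
  exact ⟨fun ⟨s, ⟨f⟩⟩ => ⟨(Embedding.induce s).comp f.toEmbedding⟩,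
    fun ⟨f⟩ => ⟨Set.range f, ⟨f.isoInduceRange⟩⟩⟩

theorem IsInducedFree.congr_right {U W : Type*} {H : SimpleGraph U} {S : SimpleGraph W}
    (h : G.IsInducedFree S) (e : S ≃g H) : G.IsInducedFree H := fun s ⟨f⟩ => h s ⟨e.trans f⟩

section

variable {U : Type*} {H : SimpleGraph U}

/-- An induced copy given by an injective map preserving adjacency in both directions. -/
def embeddingOfAdjIff (f : U → V) (hf : Function.Injective f)
    (h : ∀ i j, G.Adj (f i) (f j) ↔ H.Adj i j) : H ↪g G :=
  ⟨⟨f, hf⟩, fun {i j} => h i j⟩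

end

theorem IsInducedFree.triangleFree (h : G.IsInducedFree (cycleGraph 3)) (a b c : V)
    (hab : G.Adj a b) (hbc : G.Adj b c) : ¬ G.Adj a c := fun hac => by
  refine not_isInducedFree_iff.2 ⟨embeddingOfAdjIff ![a, b, c] ?_ ?_⟩ h
  · intro i j
    fin_cases i <;> fin_cases j <;> simp [hab.ne, hbc.ne, hac.ne, hab.ne', hbc.ne', hac.ne']
  · intro i j
    have := hab.symm
    have := hbc.symm
    have := hac.symm
    fin_cases i <;> fin_cases j <;> simp_all [cycleGraph_adj] <;> decide

theorem IsInducedFree.false_of_path (h : G.IsInducedFree (pathGraph 4)) {x u z w : V}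
    (hxu : G.Adj x u) (huz : G.Adj u z) (hzw : G.Adj z w) (hxz : x ≠ z) (hxw : x ≠ w)
    (huw : u ≠ w) (hxz' : ¬ G.Adj x z) (hxw' : ¬ G.Adj x w) (huw' : ¬ G.Adj u w) : False := by
  refine not_isInducedFree_iff.2 ⟨embeddingOfAdjIff ![x, u, z, w] ?_ ?_⟩ h
  · intro i j
    have := hxu.ne
    have := huz.ne
    have := hzw.ne
    fin_cases i <;> fin_cases j <;> simp_all [eq_comm]
  · intro i j
    fin_cases i <;> fin_cases j <;> simp_all [pathGraph_adj, adj_comm]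

theorem IsInducedFree.false_of_paw (h : G.IsInducedFree graphZ1) {a b c w : V}
    (hab : G.Adj a b) (hac : G.Adj a c) (hbc : G.Adj b c) (hcw : G.Adj c w) (ha : a ≠ w)
    (hb : b ≠ w) (haw : ¬ G.Adj a w) (hbw : ¬ G.Adj b w) : False := by
  refine not_isInducedFree_iff.2 ⟨embeddingOfAdjIff ![a, b, c, w] ?_ ?_⟩ h
  · intro i j
    have := hab.ne
    have := hac.ne
    have := hbc.ne
    have := hcw.ne
    fin_cases i <;> fin_cases j <;> simp_all [eq_comm]
  · intro i j
    fin_cases i <;> fin_cases j <;> simp_all [graphZ1, adj_comm]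

/-- If a vertex of a paw-free graph is adjacent to a vertex of a triangle, the edge joining them
lies in a triangle. -/
theorem IsInducedFree.exists_triangle (h : G.IsInducedFree graphZ1) {a b c w : V}
    (hab : G.Adj a b) (hac : G.Adj a c) (hbc : G.Adj b c) (hcw : G.Adj c w) :
    ∃ t, G.Adj c t ∧ G.Adj w t := by
  by_cases ha : a = w
  · subst ha
    exact ⟨b, hbc.symm, hab⟩
  by_cases hb : b = w
  · subst hb
    exact ⟨a, hac.symm, hab.symm⟩
  by_cases haw : G.Adj a w
  · exact ⟨a, hac.symm, haw.symm⟩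
  by_cases hbw : G.Adj b w
  · exact ⟨b, hbc.symm, hbw.symm⟩
  exact (h.false_of_paw hab hac hbc hcw ha hb haw hbw).elim

/-- A connected paw-free graph containing a triangle has diameter at most two. -/
theorem IsInducedFree.exists_common_neighbor (h : G.IsInducedFree graphZ1) (hG : G.Connected)
    {a b c : V} (hab : G.Adj a b) (hac : G.Adj a c) (hbc : G.Adj b c) (x y : V) (hxy : x ≠ y)
    (hadj : ¬ G.Adj x y) : ∃ z, G.Adj x z ∧ G.Adj y z := by
  have htri : ∀ v, ∃ s t, G.Adj s t ∧ G.Adj s v ∧ G.Adj t v := by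
    intro v
    have hr := (reachable_iff_reflTransGen c v).1 (hG.preconnected c v)
    induction hr with
    | refl => exact ⟨a, b, hab, hac, hbc⟩
    | tail _ hzw ih =>
      obtain ⟨s, t, hst, hs, ht⟩ := ih
      obtain ⟨r, hr, hr'⟩ := h.exists_triangle hst hs ht hzw
      exact ⟨_, r, hr, hzw, hr'.symm⟩
  refine hG.exists_common_neighbor (fun x u z w hxu huz hzw hxz hxw huw hxz' hxw' huw' => ?_)
    x y hxy hadj
  obtain ⟨s, t, hst, hs, ht⟩ := htri u
  obtain ⟨r, hur, hxr⟩ := h.exists_triangle hst hs ht hxu.symm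
  -- Two paws: the triangle x, r, u with z forces r ~ z, and then the triangle u, r, z with w forces
  -- r ~ w.
  have hrz : G.Adj r z := by
    by_contra hno
    refine h.false_of_paw hxr hxu hur.symm huz hxz ?_ hxz' hno
    rintro rfl
    exact hxz' hxr
  refine ⟨r, hxr, ?_⟩
  by_contra hno
  refine h.false_of_paw hur huz hrz hzw huw ?_ huw' fun h => hno h.symm
  rintro rfl
  exact hxw' hxr

theorem IsOMinusOneHeavy.isClawHeavy [Fintype V] [DecidableRel G.Adj]
    (h : G.IsOMinusOneHeavy claw) : G.IsClawHeavy := by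
  intro c x y z hcx hcy hcz hxy hxz hyz hxy' hxz' hyz'
  have hf : Function.Injective (Sum.elim ![c] ![x, y, z]) := by
    have := hcx.ne
    have := hcy.ne
    have := hcz.ne
    rintro (i | i) (j | j) <;> fin_cases i <;> fin_cases j <;> simp_all [eq_comm]
  have hfa : ∀ i j, G.Adj (Sum.elim ![c] ![x, y, z] i) (Sum.elim ![c] ![x, y, z] j) ↔
      claw.Adj i j := by
    rintro (i | i) (j | j) <;> fin_cases i <;> fin_cases j <;> simp_all [claw, adj_comm]
  obtain ⟨u, ⟨i, rfl⟩, v, ⟨j, rfl⟩, huv, hadj, hd⟩ :=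
    h _ ⟨(embeddingOfAdjIff _ hf hfa).isoInduceRange⟩
  change G.IsHeavyPair (Sum.elim ![c] ![x, y, z] i) (Sum.elim ![c] ![x, y, z] j) at hd
  replace huv : i ≠ j := fun e => huv (by rw [e])
  replace hadj : ¬ claw.Adj i j := fun e => hadj ((hfa i j).2 e)
  rcases i with i | i <;> rcases j with j | j <;> fin_cases i <;> fin_cases j <;>
    first
    | exact .inl hd
    | exact .inr (.inl hd)
    | exact .inr (.inr hd)
    | exact .inl hd.symm
    | exact .inr (.inl hd.symm)
    | exact .inr (.inr hd.symm)
    | exact absurd rfl huv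
    | exact absurd (by simp [claw]) hadj

theorem IsOMinusOneHeavy.isTraceable [Fintype V] [DecidableRel G.Adj]
    (h : G.IsOMinusOneHeavy claw) (hG : G.Connected)
    (hfree : G.IsInducedFree (cycleGraph 3) ∨ G.IsInducedFree graphZ1 ∨
      G.IsInducedFree (pathGraph 4)) : G.IsTraceable := by
  have H := h.isClawHeavy
  have := hG.nonempty
  rcases hfree with hf | hf | hf
  · exact H.isTraceable_of_triangleFree hG hf.triangleFree
  · by_cases ht : ∀ a b c, G.Adj a b → G.Adj b c → ¬ G.Adj a c
    · exact H.isTraceable_of_triangleFree hG ht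
    · push Not at ht
      obtain ⟨a, b, c, hab, hbc, hac⟩ := ht
      exact H.isTraceable_of_common_neighbor (hf.exists_common_neighbor hG hab hac hbc)
  · refine H.isTraceable_of_common_neighbor (hG.exists_common_neighbor ?_)
    intro x u z w hxu huz hzw hxz hxw huw hxz' hxw' huw'
    exact (hf.false_of_path hxu huz hzw hxz hxw huw hxz' hxw' huw').elim

end SimpleGraph

/-! ### Two non-traceable graphs and necessity -/

namespace SimpleGraph

/-- The net: a triangle `0, 1, 2` with a pendant vertex `i + 3` attached to each `i`. -/
def net : SimpleGraph (Fin 6) :=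
  fromRel fun i j => (i < 3 ∧ j < 3) ∨ i.val + 3 = j.val

/-- The join of a triangle `0, 1, 2` with three isolated vertices `3, 4, 5`, with a pendant
vertex `i + 3` attached to each `i` of the latter. -/
def bullFreeNet : SimpleGraph (Fin 9) :=
  fromRel fun i j => (i < 3 ∧ j < 6) ∨ (3 ≤ i ∧ i.val + 3 = j.val)

instance : DecidableRel net.Adj := fun i j =>
  inferInstanceAs (Decidable (i ≠ j ∧ (((i < 3 ∧ j < 3) ∨ i.val + 3 = j.val) ∨
    ((j < 3 ∧ i < 3) ∨ j.val + 3 = i.val))))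

instance : DecidableRel bullFreeNet.Adj := fun i j =>
  inferInstanceAs (Decidable (i ≠ j ∧ (((i < 3 ∧ j < 6) ∨ (3 ≤ i ∧ i.val + 3 = j.val)) ∨
    ((j < 3 ∧ i < 6) ∨ (3 ≤ j ∧ j.val + 3 = i.val)))))

/-- The net has no induced claw at all. -/
theorem net_isClawHeavy : net.IsClawHeavy := by
  suffices ∀ c x, net.Adj c x → ∀ y, net.Adj c y → x ≠ y → ¬ net.Adj x y → ∀ z, net.Adj c z →
      x ≠ z → y ≠ z → ¬ net.Adj x z → net.Adj y z by
    intro c x y z hx hy hz hxy hxz hyz hxy' hxz' hyz'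
    exact absurd (this c x hx y hy hxy hxy' z hz hxz hyz hxz') hyz'
  decide +kernel

/-- The leaves of every induced claw are 3, 4, 5, each of degree 4, so the bound 9 - 1 is attained
exactly. -/
theorem bullFreeNet_isClawHeavy : bullFreeNet.IsClawHeavy := by
  have key : ∀ c x, bullFreeNet.Adj c x → ∀ y, bullFreeNet.Adj c y → x ≠ y →
      ¬ bullFreeNet.Adj x y → ∀ z, bullFreeNet.Adj c z → x ≠ z → y ≠ z → ¬ bullFreeNet.Adj x z →
      ¬ bullFreeNet.Adj y z → (3 ≤ x ∧ x < 6) ∧ (3 ≤ y ∧ y < 6) := by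
    decide +kernel
  have hdeg : ∀ x : Fin 9, 3 ≤ x ∧ x < 6 → bullFreeNet.degree x = 4 := by
    decide +kernel
  intro c x y z hx hy hz hxy hxz hyz hxy' hxz' hyz'
  obtain ⟨h1, h2⟩ := key c x hx y hy hxy hxy' z hz hxz hyz hxz' hyz'
  left
  simp [IsHeavyPair, hdeg x h1, hdeg y h2]

theorem net_connected : net.Connected := by
  rw [connected_iff_exists_forall_reachable]
  have : ∀ w : Fin 6, 0 = w ∨ net.Adj 0 w ∨ ∃ u, net.Adj 0 u ∧ net.Adj u w := by decide +kernel
  refine ⟨0, fun w => ?_⟩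
  rcases this w with rfl | h | ⟨u, h, h'⟩
  · rfl
  · exact h.reachable
  · exact h.reachable.trans h'.reachable

theorem bullFreeNet_connected : bullFreeNet.Connected := by
  rw [connected_iff_exists_forall_reachable]
  have : ∀ w : Fin 9, 0 = w ∨ bullFreeNet.Adj 0 w ∨
      ∃ u, bullFreeNet.Adj 0 u ∧ bullFreeNet.Adj u w := by decide +kernel
  refine ⟨0, fun w => ?_⟩
  rcases this w with rfl | h | ⟨u, h, h'⟩
  · rfl
  · exact h.reachable
  · exact h.reachable.trans h'.reachable

/-- Every triangle contains two of the vertices 0, 1, 2, which have the same closed neighbourhood,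
so at most one of its vertices has a private neighbour. -/
theorem bullFreeNet_bullFree : ∀ a b, bullFreeNet.Adj a b → ∀ c, bullFreeNet.Adj a c →
    bullFreeNet.Adj b c → ∀ r, bullFreeNet.Adj a r → ¬ bullFreeNet.Adj b r →
    ¬ bullFreeNet.Adj c r → ∀ s, bullFreeNet.Adj b s → ¬ bullFreeNet.Adj a s →
    ¬ bullFreeNet.Adj c s → bullFreeNet.Adj r s := by
  decide +kernel

/-- Absence of isolated vertices stands in for connectedness, which keeps the finite check
decidable. The last alternative is a set containing a bull. -/
theorem net_induced_cases : ∀ s : Finset (Fin 6), 3 ≤ s.card →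
    (∀ v ∈ s, ∃ w ∈ s, net.Adj v w) → ∃ i < 3, ∃ j < 3, ∃ k < 3, i ≠ j ∧ i ≠ k ∧ j ≠ k ∧
      (s = {j, i, i + 3} ∨ s = {i, j, k} ∨ s = {i, j, k, k + 3} ∨ s = {i + 3, i, j, j + 3} ∨
        {i, j, k, i + 3, j + 3} ⊆ s) := by
  decide +kernel

variable {V : Type*} {G : SimpleGraph V}

theorem IsPathList.eq_head_or_eq_last {l : List V} (h : G.IsPathList l) {x : V} (hx : x ∈ l)
    (hleaf : ∀ u w, G.Adj x u → G.Adj x w → u = w) : l.head? = some x ∨ l.getLast? = some x := by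
  obtain ⟨A, B, rfl⟩ := List.append_of_mem hx
  by_cases hA : A = []
  · left
    simp [hA]
  by_cases hB : B = []
  · right
    simp [hB]
  obtain ⟨A, a, rfl⟩ := (List.eq_nil_or_concat' A).resolve_left hA
  obtain ⟨b, B, rfl⟩ := List.exists_cons_of_ne_nil hB
  have hc := h.1
  have hnd := h.2
  rw [List.append_assoc, List.singleton_append] at hc
  obtain ⟨-, hax, hxb⟩ := List.isChain_append_cons_cons.1 hc
  have := hleaf a b hax.symm hxb.rel
  subst this
  simp [List.nodup_append] at hnd

/-- A graph with three vertices of degree at most one is not traceable. -/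
theorem not_isTraceable_of_leaves {x y z : V} (hxy : x ≠ y) (hxz : x ≠ z) (hyz : y ≠ z)
    (hx : ∀ u w, G.Adj x u → G.Adj x w → u = w) (hy : ∀ u w, G.Adj y u → G.Adj y w → u = w)
    (hz : ∀ u w, G.Adj z u → G.Adj z w → u = w) : ¬ G.IsTraceable := by
  intro h
  obtain ⟨l, hl, hall⟩ := h.exists_pathList
  rcases hl.eq_head_or_eq_last (hall x) hx with h1 | h1 <;>
    rcases hl.eq_head_or_eq_last (hall y) hy with h2 | h2 <;>
    rcases hl.eq_head_or_eq_last (hall z) hz with h3 | h3 <;> simp_all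

theorem IsClawHeavy.isOMinusOneHeavy [Fintype V] [DecidableRel G.Adj] (H : G.IsClawHeavy) :
    G.IsOMinusOneHeavy claw := by
  rintro s ⟨f⟩
  have hadj : ∀ i j, G.Adj (f i) (f j) ↔ claw.Adj i j := fun i j => f.map_adj_iff
  have hne : ∀ i j, i ≠ j → (f i : V) ≠ f j := fun i j h e => h (f.injective (Subtype.ext e))
  rcases H (f (.inl 0)) (f (.inr 0)) (f (.inr 1)) (f (.inr 2)) ((hadj _ _).2 (by simp [claw]))
    ((hadj _ _).2 (by simp [claw])) ((hadj _ _).2 (by simp [claw])) (hne _ _ (by simp))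
    (hne _ _ (by simp)) (hne _ _ (by simp)) (by rw [hadj]; simp [claw])
    (by rw [hadj]; simp [claw]) (by rw [hadj]; simp [claw]) with h | h | h
  all_goals
    refine ⟨_, (f _).2, _, (f _).2, ?_, ?_, h⟩
    · exact hne _ _ (by simp)
    · rw [hadj]
      simp [claw]

theorem IsClawHeavy.iso {U : Type*} {H : SimpleGraph U} [Fintype V] [DecidableRel G.Adj]
    [Fintype U] [DecidableRel H.Adj] (e : G ≃g H) (h : H.IsClawHeavy) : G.IsClawHeavy := by
  have hp : ∀ x y, H.IsHeavyPair (e x) (e y) → G.IsHeavyPair x y := fun x y h => by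
    unfold IsHeavyPair at h ⊢
    rwa [e.degree_eq, e.degree_eq, ← Fintype.card_congr e.toEquiv] at h
  intro c x y z hcx hcy hcz hxy hxz hyz hxy' hxz' hyz'
  exact (h (e c) (e x) (e y) (e z) (e.map_adj_iff.2 hcx) (e.map_adj_iff.2 hcy)
    (e.map_adj_iff.2 hcz) (e.injective.ne hxy) (e.injective.ne hxz) (e.injective.ne hyz)
    (e.map_adj_iff.not.2 hxy') (e.map_adj_iff.not.2 hxz') (e.map_adj_iff.not.2 hyz')).imp
    (hp _ _) (Or.imp (hp _ _) (hp _ _))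

/-- If all connected claw-heavy `S`-free graphs are traceable, then `S` is an induced subgraph of
every connected claw-heavy graph with three leaves. -/
theorem nonempty_embedding_of_leaves {W : Type u} {S : SimpleGraph W}
    (h : ∀ (V : Type v) [Fintype V] (G : SimpleGraph V) [DecidableRel G.Adj],
      G.Connected → G.IsOMinusOneHeavy claw → G.IsInducedFree S → G.IsTraceable)
    {n : ℕ} {H : SimpleGraph (Fin n)} [DecidableRel H.Adj] (hconn : H.Connected)
    (hclaw : H.IsClawHeavy) {x y z : Fin n} (hxy : x ≠ y) (hxz : x ≠ z) (hyz : y ≠ z)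
    (hx : ∀ u w, H.Adj x u → H.Adj x w → u = w) (hy : ∀ u w, H.Adj y u → H.Adj y w → u = w)
    (hz : ∀ u w, H.Adj z u → H.Adj z w → u = w) : Nonempty (S ↪g H) := by
  classical
  -- The hypothesis concerns graphs in universe `v`, so the concrete graph is lifted there.
  let e : H.comap (Equiv.ulift.{v} : ULift.{v} (Fin n) ≃ Fin n) ≃g H := Iso.comap _ _
  by_contra hno
  refine not_isTraceable_of_leaves (x := ULift.up x) (y := ULift.up y) (z := ULift.up z)
    (by simpa using hxy) (by simpa using hxz) (by simpa using hyz)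
    (fun u w hu hw => ULift.ext _ _ (hx _ _ hu hw)) (fun u w hu hw => ULift.ext _ _ (hy _ _ hu hw))
    (fun u w hu hw => ULift.ext _ _ (hz _ _ hu hw))
    (h _ _ (e.connected_iff.2 hconn) (IsClawHeavy.iso e hclaw).isOMinusOneHeavy ?_)
  by_contra hfree
  obtain ⟨f⟩ := not_isInducedFree_iff.1 hfree
  exact hno ⟨e.toEmbedding.comp f⟩

theorem nonempty_iso_of_range_eq {U W : Type*} {H : SimpleGraph U} {S : SimpleGraph W}
    (f : S ↪g G) (g : H ↪g G) (h : Set.range f = Set.range g) : Nonempty (S ≃g H) := by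
  have e := f.isoInduceRange
  rw [h] at e
  exact ⟨e.trans g.isoInduceRange.symm⟩

theorem nonempty_iso_of_embedding_net {W : Type*} [Fintype W] {S : SimpleGraph W}
    (hconn : S.Connected) (hcard : 3 ≤ Fintype.card W) (f : S ↪g net)
    (g : S ↪g bullFreeNet) : Nonempty (S ≃g pathGraph 3) ∨ Nonempty (S ≃g cycleGraph 3) ∨
      Nonempty (S ≃g graphZ1) ∨ Nonempty (S ≃g pathGraph 4) := by
  have hmem : ∀ v, v ∈ Finset.univ.image f ↔ ∃ w, f w = v := by simp
  have hdeg : ∀ v ∈ Finset.univ.image f, ∃ w ∈ Finset.univ.image f, net.Adj v w := by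
    intro v hv
    obtain ⟨a, rfl⟩ := (hmem v).1 hv
    have : Nontrivial W := Fintype.one_lt_card_iff_nontrivial.1 (by omega)
    obtain ⟨b, hb⟩ := hconn.preconnected.exists_adj_of_nontrivial a
    exact ⟨f b, (hmem _).2 ⟨b, rfl⟩, f.map_adj_iff.2 hb⟩
  obtain ⟨i, hi, j, hj, k, hk, hij, hik, hjk, hs⟩ := net_induced_cases (Finset.univ.image f)
    (by rwa [Finset.card_image_of_injective _ f.injective, Finset.card_univ]) hdeg
  have hiso : ∀ {n : ℕ} {H : SimpleGraph (Fin n)} (p : Fin n → Fin 6),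
      (Function.Injective p ∧ ∀ a b, net.Adj (p a) (p b) ↔ H.Adj a b) →
      Finset.univ.image f = Finset.univ.image p → Nonempty (S ≃g H) := by
    intro n H p hp he
    refine nonempty_iso_of_range_eq f (embeddingOfAdjIff p hp.1 hp.2) ?_
    have := congrArg (fun s : Finset (Fin 6) => (s : Set (Fin 6))) he
    simpa [embeddingOfAdjIff] using this
  rcases hs with hs | hs | hs | hs | hs
  · refine .inl (hiso ![j, i, i + 3] ?_ (hs.trans ?_)) <;> clear hs
    · simp only [pathGraph_adj]
      decide +revert +kernel
    · decide +revert +kernel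
  · refine .inr (.inl (hiso ![i, j, k] ?_ (hs.trans ?_))) <;> clear hs <;>
      decide +revert +kernel
  · refine .inr (.inr (.inl (hiso ![i, j, k, k + 3] ?_ (hs.trans ?_)))) <;> clear hs
    · simp only [graphZ1, fromEdgeSet_adj]
      decide +revert +kernel
    · decide +revert +kernel
  · refine .inr (.inr (.inr (hiso ![i + 3, i, j, j + 3] ?_ (hs.trans ?_)))) <;> clear hs
    · simp only [pathGraph_adj]
      decide +revert +kernel
    · decide +revert +kernel
  · exfalso
    have hf : ∀ v ∈ ({i, j, k, i + 3, j + 3} : Finset (Fin 6)), ∃ w, f w = v :=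
      fun v hv => (hmem v).1 (hs hv)
    obtain ⟨a, ha⟩ := hf i (by simp)
    obtain ⟨b, hb⟩ := hf j (by simp)
    obtain ⟨c, hc⟩ := hf k (by simp)
    obtain ⟨r, hr⟩ := hf (i + 3) (by simp)
    obtain ⟨s, hs⟩ := hf (j + 3) (by simp)
    have hbull : ∀ i < 3, ∀ j < 3, ∀ k < 3, i ≠ j → i ≠ k → j ≠ k → net.Adj i j ∧ net.Adj i k ∧
        net.Adj j k ∧ net.Adj i (i + 3) ∧ ¬ net.Adj j (i + 3) ∧ ¬ net.Adj k (i + 3) ∧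
        net.Adj j (j + 3) ∧ ¬ net.Adj i (j + 3) ∧ ¬ net.Adj k (j + 3) ∧
        ¬ net.Adj (i + 3) (j + 3) := by
      decide +kernel
    obtain ⟨h1, h2, h3, h4, h5, h6, h7, h8, h9, h10⟩ := hbull i hi j hj k hk hij hik hjk
    rw [← hr] at h4 h5 h6 h10
    rw [← hs] at h7 h8 h9 h10
    rw [← ha] at h1 h2 h4 h8
    rw [← hb] at h1 h3 h5 h7
    rw [← hc] at h2 h3 h6 h9
    simp only [f.map_adj_iff, ← g.map_adj_iff] at h1 h2 h3 h4 h5 h6 h7 h8 h9 h10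
    exact h10 (bullFreeNet_bullFree _ _ h1 _ h2 h3 _ h4 h5 h6 _ h7 h8 h9)

end SimpleGraph

theorem theorem9 {W : Type u} [Fintype W] (S : SimpleGraph W)
    (hconn : S.Connected) (hcard : 3 ≤ Fintype.card W)
    (hP3 : ¬ Nonempty (S ≃g SimpleGraph.pathGraph 3)) :
    (∀ (V : Type v) [Fintype V] (G : SimpleGraph V) [DecidableRel G.Adj],
        G.Connected → G.IsOMinusOneHeavy SimpleGraph.claw →
        G.IsInducedFree S → G.IsTraceable) ↔
      (Nonempty (S ≃g SimpleGraph.cycleGraph 3) ∨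
        Nonempty (S ≃g SimpleGraph.graphZ1) ∨
        Nonempty (S ≃g SimpleGraph.pathGraph 4)) := by
  constructor
  · intro h
    obtain ⟨f⟩ := SimpleGraph.nonempty_embedding_of_leaves h SimpleGraph.net_connected
      SimpleGraph.net_isClawHeavy (x := 3) (y := 4) (z := 5) (by decide) (by decide) (by decide)
      (by decide +kernel) (by decide +kernel) (by decide +kernel)
    obtain ⟨g⟩ := SimpleGraph.nonempty_embedding_of_leaves h SimpleGraph.bullFreeNet_connected
      SimpleGraph.bullFreeNet_isClawHeavy (x := 6) (y := 7) (z := 8) (by decide) (by decide)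
      (by decide) (by decide +kernel) (by decide +kernel) (by decide +kernel)
    exact (SimpleGraph.nonempty_iso_of_embedding_net hconn hcard f g).resolve_left hP3
  · rintro h V _ G _ hG hclaw hfree
    refine hclaw.isTraceable hG ?_
    exact h.imp (fun ⟨e⟩ => hfree.congr_right e) (Or.imp (fun ⟨e⟩ => hfree.congr_right e)
      fun ⟨e⟩ => hfree.congr_right e)
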